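/- For a topological space $Y$, the order of a finite open cover $\beta$ of $Y$ is $\operatorname{ord}(\beta)=-1+\max_{y\in Y}\#\{V\in\beta: y\in V\}$ (the maximum over the empty space being $0$), and the Lebesgue covering dimension is $\dim Y=\sup_\alpha\min_\beta \operatorname{ord}(\beta)$, where $\alpha$ runs over all finite open covers of $Y$ and $\beta$ over all finite open covers refining $\alpha$; in particular $\dim\emptyset=-1$. **Theorem.** Let $d\ge 0$ and $m\ge 1$ be integers, let $X$ be a compact metric space with $\dim X=d$, and let $T:X\to X$ be a homeomorphism. For $n\ge 1$ let $P_n=\{x\in X: T^ix=x\text{ for some }1\le i\le n\}$, with the subspace topology, and assume that $\dim P_n<mn/2$ for all $1\le n\le 2d$. Then the set of functions $h\in C(X,[0,1]^m)$ for which the delay map $$X\to([0,1]^m)^{2d+1},\qquad x\mapsto\bigl(h(x),h(Tx),\dots,h(T^{2d}x)\bigr),$$ is a topological embedding is comeagre in $C(X,[0,1]^m)$ with the supremum topology, i.e. it is the complement of a countable union of nowhere dense sets. -/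

import Mathlib

/-- `α` is a finite open cover of the space `X`. -/
structure IsFiniteOpenCover {X : Type*} [TopologicalSpace X] (α : Set (Set X)) : Prop where
  finite : α.Finite
  isOpen : ∀ U ∈ α, IsOpen U
  covers : ⋃₀ α = Set.univ

/-- `β` refines `α`: every member of `β` lies in some member of `α`. -/
def CoverRefines {X : Type*} (β α : Set (Set X)) : Prop :=
  ∀ V ∈ β, ∃ U ∈ α, V ⊆ U

/-- The order of a (finite) cover: the largest number of members that share a point, minus one.
On the empty space it is `-1`. -/
noncomputable def coverOrder {X : Type*} (α : Set (Set X)) : ℤ :=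
  -1 + ((⨆ x : X, {U : Set X | U ∈ α ∧ x ∈ U}.ncard : ℕ) : ℤ)

/-- The Lebesgue covering dimension: the supremum over all finite open covers `α` of the least
order of a finite open cover that refines `α`. It is `-1` for the empty space and may be `⊤`. -/
noncomputable def coveringDim (X : Type*) [TopologicalSpace X] : EReal :=
  ⨆ (α : Set (Set X)) (_ : IsFiniteOpenCover α),
    ⨅ (β : Set (Set X)) (_ : IsFiniteOpenCover β ∧ CoverRefines β α), ((coverOrder β : ℝ) : EReal)

/-- The set of points `x` with `T^i x = x` for some `1 ≤ i ≤ n`. -/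
def periodicUpTo {X : Type*} (T : X → X) (n : ℕ) : Set X :=
  {x | ∃ i : ℕ, 1 ≤ i ∧ i ≤ n ∧ T^[i] x = x}

/-- The delay map `x ↦ (h x, h (T x), …, h (T^(N-1) x))`. -/
def delayMap {X Y : Type*} (T : X → X) (h : X → Y) (N : ℕ) : X → Fin N → Y :=
  fun x i => h (T^[i] x)

open Set Filter Topology

/-! As `X` is compact, the delay map is an embedding once it is injective. By the Lindelöf property
the off-diagonal pairs are covered by countably many compact sets of pairs; for each, the good maps
form an open set, so only density is at stake (`GenericallySeparated.of_locally`, `.of_isCompact`).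

Sort points by minimal period `p`, capped at a bound. On a closed piece of covering multiplicity
`r`, a partition of unity makes the orbit vector `(h (T^i z))_{i<p}` run through a complex of
dimension below `r` in a space of dimension `pm`, with vertices free up to small moves. With `N =
2d+1`, the dimension hypotheses give `2r ≤ m * min p N + 1`.

If two orbit segments are disjoint, their complexes are placed in general position: `(r-1) + (s-1) <
pm` for `q ≤ p` keeps them apart (`genericallySeparated_disjoint_orbits`). If `y = T^k x`, equal
delay vectors force `w i = w (i+k mod p)` for `i < N`. At least half of these relations are
independent, so the complex can avoid the resulting subspace (`genericallySeparated_same_orbit`);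
this halving accounts for the bound `mn/2`. -/

/-! ### Covering multiplicity and closed subspaces -/

/-- Every finite open cover of `Y` has a finite open refinement such that no point lies in more
than `r` of its members. -/
def HasCoverMultiplicityLE (Y : Type*) [TopologicalSpace Y] (r : ℕ) : Prop :=
  ∀ α : Set (Set Y), IsFiniteOpenCover α → ∃ β : Set (Set Y),
    IsFiniteOpenCover β ∧ CoverRefines β α ∧ ∀ y, {U | U ∈ β ∧ y ∈ U}.ncard ≤ r

theorem hasCoverMultiplicityLE_of_coveringDim_lt {Y : Type*} [TopologicalSpace Y] {c : ℝ} {r : ℕ}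
    (h : coveringDim Y < (c : EReal)) (hr : ∀ s : ℕ, (s : ℝ) < c + 1 → s ≤ r) :
    HasCoverMultiplicityLE Y r := by
  intro α hα
  have h1 := (le_iSup₂ (f := fun (α : Set (Set Y)) (_ : IsFiniteOpenCover α) =>
    ⨅ (β : Set (Set Y)) (_ : IsFiniteOpenCover β ∧ CoverRefines β α),
      ((coverOrder β : ℝ) : EReal)) α hα).trans_lt h
  obtain ⟨β, h2⟩ := iInf_lt_iff.1 h1
  obtain ⟨⟨hβ, hβα⟩, h3⟩ := iInf_lt_iff.1 h2
  refine ⟨β, hβ, hβα, fun y => ?_⟩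
  -- Without boundedness the supremum in ℕ would take the default value 0.
  have hbdd : BddAbove (range fun y : Y => {U | U ∈ β ∧ y ∈ U}.ncard) :=
    ⟨β.ncard, by rintro _ ⟨y, rfl⟩; exact ncard_le_ncard (fun U hU => hU.1) hβ.finite⟩
  refine (le_ciSup hbdd y).trans (hr _ ?_)
  rw [EReal.coe_lt_coe_iff, coverOrder] at h3
  push_cast at h3 ⊢
  linarith

theorem HasCoverMultiplicityLE.of_isClosedEmbedding {Y Z : Type*} [TopologicalSpace Y]
    [TopologicalSpace Z] {r : ℕ} (hZ : HasCoverMultiplicityLE Z r) {e : Y → Z}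
    (he : IsClosedEmbedding e) : HasCoverMultiplicityLE Y r := by
  intro α hα
  have hext : ∀ U : Set Y, ∃ V : Set Z, IsOpen U → IsOpen V ∧ e ⁻¹' V = U := by
    intro U
    by_cases hU : IsOpen U
    · obtain ⟨V, hV, rfl⟩ := he.isOpen_iff.1 hU
      exact ⟨V, fun _ => ⟨hV, rfl⟩⟩
    · exact ⟨∅, fun h => absurd h hU⟩
  choose E hE using hext
  have hc : IsOpen (range e)ᶜ := he.isClosed_range.isOpen_compl
  obtain ⟨β, hβ, hβα, hβr⟩ := hZ (insert ((range e)ᶜ) (E '' α)) {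
    finite := (hα.finite.image E).insert _
    isOpen := by
      rintro _ (rfl | ⟨U, hU, rfl⟩)
      · exact hc
      · exact (hE U (hα.isOpen U hU)).1
    covers := by
      refine eq_univ_of_forall fun x => ?_
      by_cases hx : x ∈ range e
      · obtain ⟨y, rfl⟩ := hx
        obtain ⟨U, hU, hxU⟩ : y ∈ ⋃₀ α := hα.covers ▸ mem_univ _
        refine ⟨E U, Or.inr ⟨U, hU, rfl⟩, ?_⟩
        rw [← (hE U (hα.isOpen U hU)).2] at hxU
        exact hxU
      · exact ⟨_, Or.inl rfl, hx⟩ }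
  have hsub : ∀ V ∈ β, ∀ y : Y, e y ∈ V → ∃ U ∈ α, e ⁻¹' V ⊆ U := by
    intro V hV y hy
    obtain ⟨U', hU', hVU⟩ := hβα V hV
    rcases hU' with rfl | ⟨U, hU, rfl⟩
    · exact absurd (mem_range_self y) (hVU hy)
    · refine ⟨U, hU, ?_⟩
      rw [← (hE U (hα.isOpen U hU)).2]
      exact preimage_mono hVU
  -- Members missing the image are discarded: their empty preimages need not lie in a member of `α`,
  -- which may be empty.
  refine ⟨(fun V => e ⁻¹' V) '' {V ∈ β | ∃ y : Y, e y ∈ V},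
    ⟨(hβ.finite.subset (sep_subset _ _)).image _, ?_, ?_⟩, ?_, fun y => ?_⟩
  · rintro _ ⟨V, hV, rfl⟩
    exact (hβ.isOpen V hV.1).preimage he.continuous
  · refine eq_univ_of_forall fun y => ?_
    obtain ⟨V, hV, hyV⟩ : e y ∈ ⋃₀ β := hβ.covers ▸ mem_univ _
    exact ⟨_, ⟨V, ⟨hV, y, hyV⟩, rfl⟩, hyV⟩
  · rintro _ ⟨V, ⟨hV, y, hy⟩, rfl⟩
    exact hsub V hV y hy
  · have hfin : {V | V ∈ β ∧ e y ∈ V}.Finite := hβ.finite.subset fun V hV => hV.1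
    refine le_trans ?_ (hβr (e y))
    refine (ncard_le_ncard ?_ (hfin.image fun V => e ⁻¹' V)).trans (ncard_image_le hfin)
    rintro _ ⟨⟨V, hV, rfl⟩, hy⟩
    exact ⟨V, ⟨hV.1, hy⟩, rfl⟩

theorem HasCoverMultiplicityLE.of_isClosed_subset {X : Type*} [TopologicalSpace X] {A B : Set X}
    {r : ℕ} (hB : HasCoverMultiplicityLE B r) (hA : IsClosed A) (hAB : A ⊆ B) :
    HasCoverMultiplicityLE A r := by
  refine hB.of_isClosedEmbedding (e := inclusion hAB) ⟨IsEmbedding.inclusion hAB, ?_⟩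
  rw [range_inclusion]
  exact hA.preimage continuous_subtype_val

/-! ### General position in a finite-dimensional space -/

section GeneralPosition

variable {E : Type*} [NormedAddCommGroup E] [NormedSpace ℝ E] [FiniteDimensional ℝ E]

theorem exists_mem_forall_sub_notMem_submodule {ι : Type*} [Finite ι] {G : Set E} (hG : IsOpen G)
    (hne : G.Nonempty) (b : ι → E) (L : ι → Submodule ℝ E) (hL : ∀ i, L i ≠ ⊤) :
    ∃ v ∈ G, ∀ i, v - b i ∉ L i := by
  let : MeasurableSpace E := borel E
  have : BorelSpace E := ⟨rfl⟩
  let μ : MeasureTheory.Measure E := MeasureTheory.Measure.addHaar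
  have h0 : μ (⋃ i, {v | v - b i ∈ L i}) = 0 := by
    refine MeasureTheory.measure_iUnion_null fun i => ?_
    have : {v | v - b i ∈ L i} = (fun v => v + -b i) ⁻¹' (L i : Set E) := by
      ext v; simp [sub_eq_add_neg]
    rw [this, MeasureTheory.measure_preimage_add_right]
    exact MeasureTheory.Measure.addHaar_submodule μ (L i) (hL i)
  by_contra! hcon
  have : μ G ≤ 0 := h0 ▸ MeasureTheory.measure_mono fun v hv => by simpa using hcon v hv
  exact (hG.measure_pos μ hne).not_ge this

/-- General position: the vectors `v w` can be chosen in prescribed open sets so that no affine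
combination of at most `r` of them meets a given finite family of small affine subspaces. -/
theorem exists_affineCombination_sub_notMem_submodule {W ι : Type*} [Fintype W] [Finite ι]
    {G : W → Set E} (hG : ∀ w, IsOpen (G w)) (hne : ∀ w, (G w).Nonempty) (b : ι → E)
    (L : ι → Submodule ℝ E) {r : ℕ}
    (hr : ∀ i, Module.finrank ℝ (L i) + r ≤ Module.finrank ℝ E) :
    ∃ v : W → E, (∀ w, v w ∈ G w) ∧ ∀ c : W → ℝ, {w | c w ≠ 0}.ncard ≤ r → ∑ w, c w = 1 →
      ∀ i, ∑ w, c w • v w - b i ∉ L i := by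
  classical
  suffices H : ∀ s : Finset W, ∃ v : W → E, (∀ w, v w ∈ G w) ∧ ∀ c : W → ℝ, (∀ w ∉ s, c w = 0) →
      {w | c w ≠ 0}.ncard ≤ r → ∑ w, c w = 1 → ∀ i, ∑ w, c w • v w - b i ∉ L i by
    obtain ⟨v, hv, h⟩ := H Finset.univ
    exact ⟨v, hv, fun c => h c fun w hw => absurd (Finset.mem_univ w) hw⟩
  intro s
  induction s using Finset.induction_on with
  | empty =>
    choose v hv using hne
    refine ⟨v, hv, fun c hc _ h1 => ?_⟩
    simp [hc] at h1
  | insert w₀ s hw₀ ih =>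
    obtain ⟨v, hv, ih⟩ := ih
    -- The new vertex must avoid each `L i` enlarged by at most `r - 1` old vertices, all based at
    -- `b i`. These spaces are proper by `hr`. Weights summing to 1 allow a bad combination to be
    -- solved for the new vertex.
    obtain ⟨u, hu, hgen⟩ := exists_mem_forall_sub_notMem_submodule
      (ι := {S : Finset W // S.card + 1 ≤ r} × ι) (hG w₀) (hne w₀) (fun j => b j.2)
      (fun j => L j.2 ⊔ Submodule.span ℝ ((j.1.1.image fun w => v w - b j.2 : Finset E) : Set E))
      (by
        rintro ⟨⟨S, hS⟩, i⟩ htop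
        have h1 := Submodule.finrank_add_le_finrank_add_finrank (L i)
          (Submodule.span ℝ ((S.image fun w => v w - b i : Finset E) : Set E))
        have h2 := (finrank_span_finset_le_card (R := ℝ) (S.image fun w => v w - b i)).trans
          Finset.card_image_le
        simp only at htop
        rw [htop, finrank_top] at h1
        have h3 := hr i
        rw [Set.finrank] at h2
        omega)
    refine ⟨Function.update v w₀ u, fun w => ?_, fun c hc hcr hc1 i hi => ?_⟩
    · by_cases h : w = w₀
      · subst h; simpa using hu
      · simpa [h] using hv w
    have hupd : ∀ w ∈ Finset.univ.erase w₀, c w • Function.update v w₀ u w = c w • v w := by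
      intro w hw
      rw [Function.update_of_ne (Finset.ne_of_mem_erase hw)]
    by_cases h0 : c w₀ = 0
    · refine ih c (fun w hw => ?_) hcr hc1 i ?_
      · by_cases h : w = w₀
        · rw [h, h0]
        · exact hc w (by simp [h, hw])
      · rw [← Finset.add_sum_erase _ _ (Finset.mem_univ w₀), Finset.sum_congr rfl hupd, h0,
          zero_smul] at hi
        rwa [← Finset.add_sum_erase _ _ (Finset.mem_univ w₀), h0, zero_smul]
    · let S : Finset W := (Finset.univ.filter fun w => c w ≠ 0).erase w₀
      have hS : S.card + 1 ≤ r := by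
        rw [Finset.card_erase_add_one (by simpa using h0)]
        rwa [ncard_eq_toFinset_card', toFinset_ofPred] at hcr
      refine hgen ⟨⟨S, hS⟩, i⟩ ?_
      have hsum : ∑ w, c w • Function.update v w₀ u w - b i
          = c w₀ • (u - b i) + ∑ w ∈ S, c w • (v w - b i) := by
        have hS' : ∑ w ∈ S, c w • (v w - b i)
            = ∑ w ∈ Finset.univ.erase w₀, c w • (v w - b i) := by
          refine Finset.sum_subset (Finset.erase_subset_erase _ (Finset.subset_univ _)) ?_
          intro w hw hwS
          have : c w = 0 := by
            by_contra hcw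
            exact hwS (by simp [S, hcw, Finset.ne_of_mem_erase hw])
          rw [this, zero_smul]
        have hb : b i = c w₀ • b i + ∑ w ∈ Finset.univ.erase w₀, c w • b i := by
          rw [Finset.add_sum_erase _ (fun w => c w • b i) (Finset.mem_univ w₀), ← Finset.sum_smul,
            hc1, one_smul]
        rw [hS', ← Finset.add_sum_erase _ _ (Finset.mem_univ w₀), Finset.sum_congr rfl hupd,
          Function.update_self]
        conv_lhs => rw [hb]
        simp only [smul_sub, Finset.sum_sub_distrib]
        abel
      rw [hsum] at hi
      have hspan : ∑ w ∈ S, c w • (v w - b i) ∈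
          Submodule.span ℝ ((S.image fun w => v w - b i : Finset E) : Set E) :=
        Submodule.sum_mem _ fun w hw => Submodule.smul_mem _ _
          (Submodule.subset_span (Finset.mem_coe.2 (Finset.mem_image_of_mem _ hw)))
      have hmem : c w₀ • (u - b i) ∈ L i ⊔
          Submodule.span ℝ ((S.image fun w => v w - b i : Finset E) : Set E) := by
        have := Submodule.sub_mem _ (Submodule.mem_sup_left hi)
          (Submodule.mem_sup_right (S := L i) hspan)
        rwa [add_sub_cancel_right] at this
      exact (Submodule.smul_mem_iff _ h0).1 hmem

end GeneralPosition

/-! ### Perturbing maps into a cube -/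

section Perturbation

universe u

variable {X : Type u} [MetricSpace X] [CompactSpace X] {ι κ : Type*} [Fintype κ]

/-- A map into a cube can be changed on a closed set, within `ε`, to any map into the cube that is
`ε`-close to it there. The closed set is given by a closed embedding. -/
theorem ContinuousMap.exists_extension_dist_le {Z : Type*} [TopologicalSpace Z] [CompactSpace Z]
    {e : Z → X} (he : IsClosedEmbedding e) (f : C(X, κ → unitInterval))
    (g : C(Z, κ → unitInterval)) {ε : ℝ} (hε : 0 ≤ ε)
    (hfg : ∀ z a, |(g z a : ℝ) - f (e z) a| ≤ ε) :
    ∃ h : C(X, κ → unitInterval), dist h f ≤ ε ∧ ∀ z, h (e z) = g z := by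
  have hcont : ∀ a, Continuous fun z => (g z a : ℝ) - f (e z) a := fun a =>
    (continuous_subtype_val.comp ((continuous_apply a).comp g.continuous)).sub
      (continuous_subtype_val.comp ((continuous_apply a).comp (f.continuous.comp he.continuous)))
  -- Tietze extends the difference with the same norm; clamping the sum to `[0,1]` is 1-Lipschitz
  -- and fixes values already there.
  choose k hk1 hk2 using fun a => BoundedContinuousFunction.exists_extension_norm_eq_of_isClosedEmbedding
    (BoundedContinuousFunction.mkOfCompact ⟨_, hcont a⟩) he
  have hkε : ∀ a x, |k a x| ≤ ε := by
    intro a x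
    refine ((k a).norm_coe_le_norm x).trans ?_
    rw [hk1, BoundedContinuousFunction.norm_le hε]
    exact fun z => hfg z a
  have hke : ∀ a z, k a (e z) = (g z a : ℝ) - f (e z) a := fun a z => congrFun (hk2 a) z
  refine ⟨⟨fun x a => projIcc 0 1 zero_le_one ((f x a : ℝ) + k a x), ?_⟩, ?_, fun z => ?_⟩
  · refine continuous_pi fun a => continuous_projIcc.comp ?_
    exact (continuous_subtype_val.comp ((continuous_apply a).comp f.continuous)).add
      (k a).continuous
  · rw [ContinuousMap.dist_le hε]
    refine fun x => (dist_pi_le_iff hε).2 fun a => ?_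
    have h1 := abs_projIcc_sub_projIcc (zero_le_one (α := ℝ)) (c := (f x a : ℝ) + k a x)
      (d := (f x a : ℝ))
    rw [projIcc_val, add_sub_cancel_left] at h1
    exact h1.trans (hkε a x)
  · funext a
    change projIcc 0 1 zero_le_one ((f (e z) a : ℝ) + k a (e z)) = g z a
    rw [hke, add_sub_cancel, projIcc_val]

/-- If `A` has covering multiplicity at most `r`, and the sets `φ i '' A` are disjoint copies of
`A`, then `f` can be approximated by maps that are on all copies barycentric with respect to the
same partition of unity of multiplicity at most `r`, with vertices freely chosen in some
open sets. -/
theorem exists_partition_forall_vertices_exists_approx [Finite ι] {φ : ι → X → X}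
    (hφ : ∀ i, Continuous (φ i)) {A C : Set X} (hA : IsClosed A) (hC : IsClosed C)
    (hinj : ∀ i j, ∀ x ∈ A, ∀ y ∈ A, φ i x = φ j y → i = j ∧ x = y)
    (hdisj : ∀ i, ∀ x ∈ A, φ i x ∉ C) {r : ℕ} (hr : HasCoverMultiplicityLE A r)
    (f : C(X, κ → unitInterval)) {ε : ℝ} (hε : 0 < ε) :
    ∃ (W : Set (Set A)) (_ : Fintype W) (ψ : W → A → ℝ) (G : W → Set (ι → κ → ℝ)),
      (∀ w, IsOpen (G w)) ∧ (∀ w, (G w).Nonempty) ∧ (∀ z, ∑ w, ψ w z = 1) ∧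
      (∀ z, {w | ψ w z ≠ 0}.ncard ≤ r) ∧ ∀ v : W → ι → κ → ℝ, (∀ w, v w ∈ G w) →
        ∃ h : C(X, κ → unitInterval), dist h f ≤ ε ∧ (∀ x ∈ C, h x = f x) ∧
          ∀ z : A, (fun i a => (h (φ i z) a : ℝ)) = ∑ w, ψ w z • v w := by
  classical
  have := Fintype.ofFinite ι
  have : CompactSpace A := isCompact_iff_compactSpace.1 hA.isCompact
  have : CompactSpace C := isCompact_iff_compactSpace.1 hC.isCompact
  let F : A → ι → κ → ℝ := fun z i a => f (φ i z) a
  have hF : Continuous F := continuous_pi fun i => continuous_pi fun a =>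
    continuous_subtype_val.comp ((continuous_apply a).comp
      (f.continuous.comp ((hφ i).comp continuous_subtype_val)))
  have hδ : 0 < ε / 2 := half_pos hε
  obtain ⟨t, ht⟩ := (isCompact_univ (X := A)).elim_nhds_subcover
    (fun q => F ⁻¹' Metric.ball (F q) (ε / 2))
    (fun q _ => hF.continuousAt.preimage_mem_nhds (Metric.ball_mem_nhds _ hδ))
  obtain ⟨W, hW, hWα, hWr⟩ := hr ((fun q => F ⁻¹' Metric.ball (F q) (ε / 2)) '' (t : Set A)) {
    finite := t.finite_toSet.image _
    isOpen := by
      rintro _ ⟨q, _, rfl⟩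
      exact Metric.isOpen_ball.preimage hF
    covers := by
      rw [sUnion_image]
      exact univ_subset_iff.1 ht.2 }
  have : Fintype W := hW.finite.fintype
  have hq : ∀ w : W, ∃ q : A, ∀ z ∈ w.1, dist (F z) (F q) < ε / 2 := by
    intro w
    obtain ⟨_, ⟨q, _, rfl⟩, h⟩ := hWα w.1 w.2
    exact ⟨q, fun z hz => h hz⟩
  choose q hq using hq
  obtain ⟨ρ, hρ⟩ := PartitionOfUnity.exists_isSubordinate (isClosed_univ (X := A))
    (fun w : W => w.1) (fun w => hW.isOpen _ w.2) (by
      rw [← sUnion_eq_iUnion, hW.covers])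
  have hρw : ∀ w z, ρ w z ≠ 0 → z ∈ w.1 := fun w z h => hρ w (subset_closure h)
  have hρ1 : ∀ z, ∑ w, ρ w z = 1 := fun z => by
    rw [← finsum_eq_sum_of_fintype]; exact ρ.sum_eq_one (mem_univ z)
  -- Vertices in the open cube keep all barycentric values in the cube; since each `F (q w)` lies in
  -- its closure, such vertices exist nearby.
  let box : Set (ι → κ → ℝ) := univ.pi fun _ => univ.pi fun _ => Ioo 0 1
  have hbox : IsOpen box := isOpen_set_pi finite_univ fun _ _ =>
    isOpen_set_pi finite_univ fun _ _ => isOpen_Ioo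
  refine ⟨W, this, fun w z => ρ w z, fun w => Metric.ball (F (q w)) (ε / 2) ∩ box,
    fun w => Metric.isOpen_ball.inter hbox, fun w => ?_, hρ1, fun z => ?_, fun v hv => ?_⟩
  · have hcl : F (q w) ∈ closure box := by
      simp only [box, closure_pi_set, closure_Ioo (zero_ne_one (α := ℝ))]
      exact fun i _ a _ => (f (φ i (q w)) a).2
    exact mem_closure_iff_nhds.1 hcl _ (Metric.ball_mem_nhds _ hδ)
  · refine le_trans ?_ (hWr z)
    refine ncard_le_ncard_of_injOn (fun w : W => w.1) (fun w hw => ⟨w.2, hρw w z hw⟩)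
      Subtype.val_injective.injOn (hW.finite.subset fun V hV => hV.1)
  · let g₀ : A → ι → κ → ℝ := fun z => ∑ w, ρ w z • v w
    have hg₀ : Continuous g₀ :=
      continuous_finsetSum _ fun w _ => (ρ w).continuous.smul continuous_const
    have hg₀box : ∀ z, g₀ z ∈ box := fun z =>
      (convex_pi fun _ _ => convex_pi fun _ _ => convex_Ioo (0 : ℝ) 1).sum_mem
        (fun w _ => ρ.nonneg w z) (hρ1 z) fun w _ => (hv w).2
    have hg₀dist : ∀ z, dist (g₀ z) (F z) ≤ ε := by
      intro z
      have hsub : g₀ z - F z = ∑ w, ρ w z • (v w - F z) := by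
        simp only [smul_sub, Finset.sum_sub_distrib, ← Finset.sum_smul, hρ1, one_smul, g₀]
      rw [dist_eq_norm, hsub]
      calc ‖∑ w, ρ w z • (v w - F z)‖ ≤ ∑ w, ρ w z * ε := by
            refine norm_sum_le_of_le _ fun w _ => ?_
            rw [norm_smul, Real.norm_of_nonneg (ρ.nonneg w z)]
            by_cases h : ρ w z = 0
            · simp [h]
            · refine mul_le_mul_of_nonneg_left ?_ (ρ.nonneg w z)
              have h1 := (hv w).1
              rw [Metric.mem_ball] at h1
              have h2 := dist_triangle_right (v w) (F z) (F (q w))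
              have h3 := hq w z (hρw w z h)
              rw [← dist_eq_norm]
              linarith
        _ = ε := by rw [← Finset.sum_mul, hρ1, one_mul]
    let : TopologicalSpace ι := ⊥
    have : DiscreteTopology ι := ⟨rfl⟩
    let e : (ι × A) ⊕ C → X := Sum.elim (fun p => φ p.1 p.2) Subtype.val
    have hecont : Continuous e := by
      refine Continuous.sumElim (continuous_prod_of_discrete_left.2 fun i => ?_)
        continuous_subtype_val
      exact (hφ i).comp continuous_subtype_val
    have heinj : Function.Injective e := by
      rintro (⟨i, x⟩ | x) (⟨j, y⟩ | y) hxy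
      · obtain ⟨rfl, h⟩ := hinj i j x x.2 y y.2 hxy
        rw [Subtype.ext h]
      · exact absurd (show φ i x ∈ C from (show φ i x = y from hxy) ▸ y.2) (hdisj i x x.2)
      · exact absurd (show φ j y ∈ C from (show (x : X) = φ j y from hxy) ▸ x.2) (hdisj j y y.2)
      · rw [Subtype.ext hxy]
    have he : IsClosedEmbedding e := hecont.isClosedEmbedding heinj
    let g : C((ι × A) ⊕ C, κ → unitInterval) :=
      ⟨Sum.elim (fun p a => ⟨g₀ p.2 p.1 a, Ioo_subset_Icc_self (hg₀box p.2 p.1 trivial a trivial)⟩)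
        (fun x => f x), by
        refine Continuous.sumElim (continuous_prod_of_discrete_left.2 fun i => ?_)
          (f.continuous.comp continuous_subtype_val)
        refine continuous_pi fun a => Continuous.subtype_mk ?_ _
        exact (continuous_apply a).comp ((continuous_apply i).comp hg₀)⟩
    obtain ⟨h, hhf, hhe⟩ := ContinuousMap.exists_extension_dist_le he f g hε.le (by
      rintro (⟨i, z⟩ | x) a
      · exact (dist_le_pi_dist _ _ a).trans ((dist_le_pi_dist _ _ i).trans (hg₀dist z))
      · change |(f x a : ℝ) - f x a| ≤ ε
        rw [sub_self, abs_zero]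
        exact hε.le)
    refine ⟨h, hhf, fun x hx => hhe (Sum.inr ⟨x, hx⟩), fun z => ?_⟩
    funext i a
    exact congrArg Subtype.val (congrFun (hhe (Sum.inl (i, z))) a)

/-- Every map into a cube can be approximated by maps `h` such that the vectors `(h (φ i z))ᵢ`, for
`z ∈ A`, lie in finitely many affine subspaces of dimension less than `r`. -/
theorem exists_approx_mem_affine [Finite ι] {φ : ι → X → X}
    (hφ : ∀ i, Continuous (φ i)) {A : Set X} (hA : IsClosed A)
    (hinj : ∀ i j, ∀ x ∈ A, ∀ y ∈ A, φ i x = φ j y → i = j ∧ x = y)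
    {r : ℕ} (hr : HasCoverMultiplicityLE A r)
    (f : C(X, κ → unitInterval)) {ε : ℝ} (hε : 0 < ε) :
    ∃ h : C(X, κ → unitInterval), dist h f ≤ ε ∧
      ∃ (J : Type u) (_ : Finite J) (b : J → ι → κ → ℝ) (L : J → Submodule ℝ (ι → κ → ℝ)),
        (∀ j, Module.finrank ℝ (L j) + 1 ≤ r) ∧
        ∀ z ∈ A, ∃ j, (fun i a => (h (φ i z) a : ℝ)) - b j ∈ L j := by
  classical
  have := Fintype.ofFinite ι
  obtain ⟨W, _, ψ, G, hGo, hGne, hψ1, hψr, H⟩ :=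
    exists_partition_forall_vertices_exists_approx hφ hA isClosed_empty hinj (by simp) hr f hε
  choose v hv using hGne
  obtain ⟨h, hhf, -, hh⟩ := H v hv
  -- One affine subspace per possible face: a base vertex and at most `r - 1` others.
  refine ⟨h, hhf, {p : W × Finset W // p.2.card + 1 ≤ r}, inferInstance, fun p => v p.1.1,
    fun p => Submodule.span ℝ ((p.1.2.image fun w => v w - v p.1.1 : Finset _) : Set _),
    fun p => ?_, fun z hz => ?_⟩
  · have := (finrank_span_finset_le_card (R := ℝ) (p.1.2.image fun w => v w - v p.1.1)).trans
      Finset.card_image_le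
    rw [Set.finrank] at this
    have h2 : p.1.2.card + 1 ≤ r := p.2
    simp only
    omega
  · obtain ⟨w₀, hw₀⟩ : ∃ w, ψ w ⟨z, hz⟩ ≠ 0 := by
      by_contra! hcon
      simpa [hcon] using hψ1 ⟨z, hz⟩
    let S : Finset W := Finset.univ.filter fun w => ψ w ⟨z, hz⟩ ≠ 0
    have hw₀S : w₀ ∈ S := by simpa [S] using hw₀
    have hS : S.card ≤ r := by
      have := hψr ⟨z, hz⟩
      rwa [ncard_eq_toFinset_card', toFinset_ofPred] at this
    refine ⟨⟨(w₀, S.erase w₀), by rwa [Finset.card_erase_add_one hw₀S]⟩, ?_⟩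
    have hsum : (fun i a => (h (φ i z) a : ℝ)) - v w₀ = ∑ w, ψ w ⟨z, hz⟩ • (v w - v w₀) := by
      rw [hh ⟨z, hz⟩]
      simp only [smul_sub, Finset.sum_sub_distrib, ← Finset.sum_smul, hψ1, one_smul]
    simp only
    rw [hsum]
    refine Submodule.sum_mem _ fun w _ => ?_
    by_cases hw : ψ w ⟨z, hz⟩ = 0
    · simp [hw]
    by_cases hww : w = w₀
    · simp [hww]
    · exact Submodule.smul_mem _ _ (Submodule.subset_span
        (Finset.mem_coe.2 (Finset.mem_image_of_mem _ (by simp [S, hw, hww]))))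

/-- Every map into a cube can be approximated by maps `h` such that the vectors `(h (φ i z))ᵢ`, for
`z ∈ A`, avoid finitely many given affine subspaces of small dimension. -/
theorem exists_approx_notMem_affine [Fintype ι] {φ : ι → X → X}
    (hφ : ∀ i, Continuous (φ i)) {A C : Set X} (hA : IsClosed A) (hC : IsClosed C)
    (hinj : ∀ i j, ∀ x ∈ A, ∀ y ∈ A, φ i x = φ j y → i = j ∧ x = y)
    (hdisj : ∀ i, ∀ x ∈ A, φ i x ∉ C) {r : ℕ} (hr : HasCoverMultiplicityLE A r)
    (f : C(X, κ → unitInterval)) {ε : ℝ} (hε : 0 < ε) {J : Type*} [Finite J]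
    (b : J → ι → κ → ℝ) (L : J → Submodule ℝ (ι → κ → ℝ))
    (hL : ∀ j, Module.finrank ℝ (L j) + r ≤ Fintype.card ι * Fintype.card κ) :
    ∃ h : C(X, κ → unitInterval), dist h f ≤ ε ∧ (∀ x ∈ C, h x = f x) ∧
      ∀ z ∈ A, ∀ j, (fun i a => (h (φ i z) a : ℝ)) - b j ∉ L j := by
  obtain ⟨W, _, ψ, G, hGo, hGne, hψ1, hψr, H⟩ :=
    exists_partition_forall_vertices_exists_approx hφ hA hC hinj hdisj hr f hε
  obtain ⟨v, hv, hgen⟩ := exists_affineCombination_sub_notMem_submodule hGo hGne b L (r := r) (by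
    simpa [Module.finrank_pi_fintype] using hL)
  obtain ⟨h, hhf, hhC, hh⟩ := H v hv
  refine ⟨h, hhf, hhC, fun z hz j => ?_⟩
  rw [hh ⟨z, hz⟩]
  exact hgen _ (hψr _) (hψ1 _) j

end Perturbation

/-- Each relation expresses a coordinate in `I` through a smaller one, so the coordinates outside
`I` determine the vector. -/
theorem finrank_submodule_le_of_wellFounded {ι V : Type*} [Fintype ι] [DecidableEq ι]
    [AddCommGroup V] [Module ℝ V] [FiniteDimensional ℝ V] {lt : ι → ι → Prop} (hlt : WellFounded lt)
    (f : ι → ι) (I : Finset ι) (hI : ∀ i ∈ I, lt (f i) i) (L : Submodule ℝ (ι → V))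
    (hL : ∀ w ∈ L, ∀ i ∈ I, w i = w (f i)) :
    Module.finrank ℝ L + I.card * Module.finrank ℝ V ≤ Fintype.card ι * Module.finrank ℝ V := by
  let R : L →ₗ[ℝ] ({i // i ∉ I} → V) :=
    (LinearMap.funLeft ℝ V (Subtype.val : {i // i ∉ I} → ι)).comp L.subtype
  have hR : Function.Injective R := by
    rw [← LinearMap.ker_eq_bot, LinearMap.ker_eq_bot']
    rintro ⟨w, hw⟩ h0
    have h0' : ∀ i, i ∉ I → w i = 0 := fun i hi => congrFun h0 ⟨i, hi⟩
    have : ∀ i, w i = 0 := by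
      intro i
      induction i using hlt.induction with
      | _ i ih =>
        by_cases hi : i ∈ I
        · rw [hL w hw i hi, ih _ (hI i hi)]
        · exact h0' i hi
    exact Subtype.ext (funext this)
  have h1 := LinearMap.finrank_le_finrank_of_injective hR
  rw [Module.finrank_pi_fintype, Finset.sum_const, Finset.card_univ, Fintype.card_subtype_compl,
    Fintype.card_coe, smul_eq_mul] at h1
  calc _ ≤ (Fintype.card ι - I.card) * Module.finrank ℝ V + I.card * Module.finrank ℝ V := by gcongr
    _ = _ := by rw [← add_mul, Nat.sub_add_cancel (Finset.card_le_univ I)]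

/-! ### Period strata and generic separation -/

section Dynamics

variable {X : Type*}

/-- Points fixed by `T^[p]`, where the condition is void if `p ≥ M`. -/
def fixedUpTo (T : X → X) (M p : ℕ) : Set X := {x | p < M → T^[p] x = x}

/-- Points of minimal period `p` if `p < M`; points whose first `p` iterates are distinct
otherwise. -/
def periodStratum (T : X → X) (M p : ℕ) : Set X :=
  {x | x ∈ fixedUpTo T M p ∧ InjOn (fun i => T^[i] x) (Iio p)}

theorem exists_mem_periodStratum {T : X → X} (hT : Function.Injective T) {M : ℕ} (hM : 1 ≤ M)
    (x : X) : ∃ p, 1 ≤ p ∧ p ≤ M ∧ x ∈ periodStratum T M p := by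
  by_cases h : 0 < Function.minimalPeriod T x ∧ Function.minimalPeriod T x < M
  · exact ⟨_, h.1, h.2.le, fun _ => Function.isPeriodicPt_minimalPeriod T x,
      Function.iterate_injOn_Iio_minimalPeriod⟩
  -- The minimal period is 0 (not periodic) or at least `M`; either way the first `M` iterates are
  -- distinct.
  · refine ⟨M, hM, le_rfl, fun h => absurd h (lt_irrefl _), ?_⟩
    have key : ∀ i j, i < j → j < M → T^[i] x ≠ T^[j] x := by
      intro i j hij hj heq
      obtain ⟨k, rfl⟩ := Nat.exists_eq_add_of_lt hij
      rw [add_assoc, Function.iterate_add_apply] at heq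
      have hper : Function.IsPeriodicPt T (k + 1) x := (hT.iterate i heq).symm
      exact h ⟨hper.minimalPeriod_pos (Nat.succ_pos k),
        (hper.minimalPeriod_le (Nat.succ_pos k)).trans_lt (by omega)⟩
    intro i hi j hj hij
    by_contra hne
    rcases lt_or_gt_of_ne hne with h | h
    · exact key i j h hj hij
    · exact key j i h hi hij.symm

theorem iterate_eq_iterate_mod {T : X → X} {M p : ℕ} {x : X} (hx : x ∈ fixedUpTo T M p) {i : ℕ}
    (hi : M ≤ p → i < p) : T^[i] x = T^[i % p] x := by
  by_cases h : p < M
  · exact (Function.IsPeriodicPt.iterate_mod_apply (hx h) i).symm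
  · rw [Nat.mod_eq_of_lt (hi (not_lt.1 h))]

theorem isClosed_fixedUpTo [TopologicalSpace X] [T2Space X] {T : X → X} (hT : Continuous T)
    (M p : ℕ) : IsClosed (fixedUpTo T M p) := by
  by_cases h : p < M
  · simpa [fixedUpTo, h] using isClosed_eq (hT.iterate p) continuous_id
  · simp [fixedUpTo, h]

theorem exists_isClosed_nhds_iterate_ne [TopologicalSpace X] [T2Space X] [RegularSpace X]
    {T : X → X} (hT : Continuous T) {p q : ℕ} {x y : X}
    (h : ∀ i < p, ∀ j < q, T^[i] x ≠ T^[j] y) :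
    ∃ U ∈ 𝓝 x, ∃ V ∈ 𝓝 y, IsClosed U ∧ IsClosed V ∧
      ∀ a ∈ U, ∀ b ∈ V, ∀ i < p, ∀ j < q, T^[i] a ≠ T^[j] b := by
  have hev : ∀ᶠ z : X × X in 𝓝 (x, y), ∀ i < p, ∀ j < q, T^[i] z.1 ≠ T^[j] z.2 := by
    refine (finite_Iio p).eventually_all.2 fun i hi => (finite_Iio q).eventually_all.2 fun j hj => ?_
    exact (isOpen_ne_fun ((hT.iterate i).comp continuous_fst)
      ((hT.iterate j).comp continuous_snd)).mem_nhds (h i hi j hj)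
  rw [nhds_prod_eq] at hev
  obtain ⟨⟨U, V⟩, ⟨⟨hU, hUc⟩, hV, hVc⟩, hUV⟩ :=
    ((closed_nhds_basis x).prod (closed_nhds_basis y)).mem_iff.1 hev
  exact ⟨U, hU, V, hV, hUc, hVc, fun a ha b hb =>
    hUV (mk_mem_prod ha hb : (a, b) ∈ U ×ˢ V)⟩

theorem exists_isClosed_nhds_iterate_injective [TopologicalSpace X] [T2Space X] [RegularSpace X]
    {T : X → X} (hT : Continuous T) (hTi : Function.Injective T) {p : ℕ} {x : X}
    (h : InjOn (fun i => T^[i] x) (Iio p)) :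
    ∃ U ∈ 𝓝 x, IsClosed U ∧ ∀ i j : Fin p, ∀ a ∈ U, ∀ b ∈ U, T^[i] a = T^[j] b → i = j ∧ a = b := by
  have hev : ∀ᶠ z : X × X in 𝓝 (x, x), ∀ i j : Fin p, i ≠ j → T^[i] z.1 ≠ T^[j] z.2 := by
    refine eventually_all.2 fun i => eventually_all.2 fun j => ?_
    by_cases hij : i = j
    · simp [hij]
    · filter_upwards [(isOpen_ne_fun ((hT.iterate i).comp continuous_fst)
        ((hT.iterate j).comp continuous_snd)).mem_nhds
          (show (x, x) ∈ {z : X × X | T^[i] z.1 ≠ T^[j] z.2} from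
            fun heq => hij (Fin.ext (h i.2 j.2 heq)))] with z hz _ using hz
  rw [nhds_prod_eq] at hev
  obtain ⟨U, ⟨hU, hUc⟩, hUU⟩ := (closed_nhds_basis x).prod_self.mem_iff.1 hev
  refine ⟨U, hU, hUc, fun i j a ha b hb heq => ?_⟩
  by_cases hij : i = j
  · subst hij
    exact ⟨rfl, hTi.iterate i heq⟩
  · exact absurd heq (hUU (mk_mem_prod ha hb) i j hij)

/-- The maps whose delay map separates all pairs in `S` form a comeagre set. -/
def GenericallySeparated [TopologicalSpace X] (T : X → X) (m N : ℕ) (S : Set (X × X)) : Prop :=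
  {h : C(X, Fin m → unitInterval) | ∀ z ∈ S, delayMap T h N z.1 ≠ delayMap T h N z.2} ∈
    residual C(X, Fin m → unitInterval)

variable [MetricSpace X] {T : X → X} {m N : ℕ}

theorem GenericallySeparated.mono {S S' : Set (X × X)} (h : GenericallySeparated T m N S')
    (hS : S ⊆ S') : GenericallySeparated T m N S :=
  mem_of_superset h fun _ hh z hz => hh z (hS hz)

theorem GenericallySeparated.sUnion {𝒮 : Set (Set (X × X))} (h𝒮 : 𝒮.Countable)
    (h : ∀ S ∈ 𝒮, GenericallySeparated T m N S) : GenericallySeparated T m N (⋃₀ 𝒮) :=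
  mem_of_superset ((countable_bInter_mem h𝒮).2 h) fun f hf z ⟨S, hS, hz⟩ => by
    exact (mem_iInter₂.1 hf S hS) z hz

theorem GenericallySeparated.swap {S : Set (X × X)} (h : GenericallySeparated T m N S) :
    GenericallySeparated T m N (Prod.swap ⁻¹' S) :=
  mem_of_superset h fun _ hf z hz => (hf z.swap hz).symm

variable [CompactSpace X]

theorem GenericallySeparated.of_locally {S : Set (X × X)}
    (h : ∀ z ∈ S, ∃ t ∈ 𝓝[S] z, GenericallySeparated T m N t) : GenericallySeparated T m N S :=
  (HereditarilyLindelofSpace.isLindelof S).induction_on (fun _ _ hst ht => ht.mono hst)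
    (fun _ => GenericallySeparated.sUnion) h

theorem GenericallySeparated.of_isCompact (hT : Continuous T) {K : Set (X × X)} (hK : IsCompact K)
    (h : ∀ (f : C(X, Fin m → unitInterval)) (ε : ℝ), 0 < ε →
      ∃ g : C(X, Fin m → unitInterval), dist g f ≤ ε ∧
        ∀ z ∈ K, delayMap T g N z.1 ≠ delayMap T g N z.2) : GenericallySeparated T m N K := by
  refine residual_of_dense_open ?_ ?_
  · rw [isOpen_iff_eventually]
    intro f hf
    refine hK.eventually_forall_of_forall_eventually fun z hz => ?_
    have hc : ∀ i : ℕ, Continuous (T^[i]) := hT.iterate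
    refine (isOpen_ne_fun (f := fun y : C(X, Fin m → unitInterval) × (X × X) =>
      delayMap T y.1 N y.2.1) (g := fun y => delayMap T y.1 N y.2.2) ?_ ?_).mem_nhds (hf z hz)
    · refine continuous_pi fun i => ?_
      exact continuous_fst.eval ((hc i).comp (continuous_fst.comp continuous_snd))
    · refine continuous_pi fun i => ?_
      exact continuous_fst.eval ((hc i).comp (continuous_snd.comp continuous_snd))
  · rw [Metric.dense_iff]
    intro f ε hε
    obtain ⟨g, hgf, hg⟩ := h f (ε / 2) (half_pos hε)
    exact ⟨g, Metric.mem_ball.2 (hgf.trans_lt (half_lt_self hε)), hg⟩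

end Dynamics

/-! ### Separating pairs of points -/

section Separation

universe u

variable {X : Type u} [MetricSpace X] [CompactSpace X] {T : X → X} {m N : ℕ}

theorem genericallySeparated_disjoint_orbits (hT : Continuous T) (hTi : Function.Injective T)
    {p q r s : ℕ} (hq : 0 < q) (hpN : p ≤ N)
    (hr : HasCoverMultiplicityLE (fixedUpTo T N p) r)
    (hs : HasCoverMultiplicityLE (fixedUpTo T N q) s) (hrs : r + s ≤ p * m + 1) :
    GenericallySeparated T m N {z | z.1 ∈ periodStratum T N p ∧ z.2 ∈ periodStratum T N q ∧
      ∀ i < p, ∀ j < q, T^[i] z.1 ≠ T^[j] z.2} := by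
  refine .of_locally ?_
  rintro ⟨x, y⟩ ⟨hx, hy, hxy⟩
  obtain ⟨U₁, hU₁, V₁, hV₁, hU₁c, hV₁c, hUV⟩ := exists_isClosed_nhds_iterate_ne hT hxy
  obtain ⟨U₂, hU₂, hU₂c, hU⟩ := exists_isClosed_nhds_iterate_injective hT hTi hx.2
  obtain ⟨V₂, hV₂, hV₂c, hV⟩ := exists_isClosed_nhds_iterate_injective hT hTi hy.2
  let A := U₁ ∩ U₂ ∩ fixedUpTo T N p
  let B := V₁ ∩ V₂ ∩ fixedUpTo T N q
  have hA : IsClosed A := (hU₁c.inter hU₂c).inter (isClosed_fixedUpTo hT N p)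
  have hB : IsClosed B := (hV₁c.inter hV₂c).inter (isClosed_fixedUpTo hT N q)
  refine ⟨A ×ˢ B, ?_, .of_isCompact hT (hA.isCompact.prod hB.isCompact) fun f ε hε => ?_⟩
  · filter_upwards [self_mem_nhdsWithin, nhdsWithin_le_nhds
      (prod_mem_nhds (inter_mem hU₁ hU₂) (inter_mem hV₁ hV₂))] with z hz hz'
    exact ⟨⟨hz'.1, hz.1.1⟩, ⟨hz'.2, hz.2.1.1⟩⟩
  obtain ⟨g, hgf, J, _, b, L, hL, hbL⟩ := exists_approx_mem_affine (φ := fun i : Fin q => T^[i])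
    (fun i => hT.iterate i) hB (fun i j a ha c hc => hV i j a ha.1.2 c hc.1.2)
    (hs.of_isClosed_subset hB inter_subset_right) f (half_pos hε)
  -- The second perturbation is frozen on the orbit segments of `B`, so it keeps the affine
  -- subspaces found for them.
  let C : Set X := ⋃ j : Fin q, T^[j] '' B
  have hC : IsClosed C := isClosed_iUnion_of_finite fun j =>
    (hB.isCompact.image (hT.iterate j)).isClosed
  -- Periodic repetition turns `q` values along the orbit of `c` into its first `p` delay
  -- coordinates.
  let R : (Fin q → Fin m → ℝ) →ₗ[ℝ] (Fin p → Fin m → ℝ) :=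
    LinearMap.funLeft ℝ (Fin m → ℝ) fun i : Fin p => (⟨i % q, Nat.mod_lt _ hq⟩ : Fin q)
  obtain ⟨h, hhg, hhC, hh⟩ := exists_approx_notMem_affine (φ := fun i : Fin p => T^[i])
    (fun i => hT.iterate i) hA hC (fun i j a ha c hc => hU i j a ha.1.2 c hc.1.2) (by
      rintro i a ha hmem
      obtain ⟨j, c, hc, hcj⟩ := mem_iUnion.1 hmem
      exact hUV a ha.1.1 c hc.1.1 i i.2 j j.2 hcj.symm)
    (hr.of_isClosed_subset hA inter_subset_right) g (half_pos hε) (fun j => R (b j))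
    (fun j => (L j).map R) (fun j => by
      have h1 := Submodule.finrank_map_le R (L j)
      have h2 := hL j
      simp only [Fintype.card_fin]
      omega)
  refine ⟨h, (dist_triangle h g f).trans (by linarith), ?_⟩
  rintro ⟨a, c⟩ ⟨ha, hc⟩ heq
  obtain ⟨j, hj⟩ := hbL c hc
  refine hh a ha j ?_
  have hac : (fun (i : Fin p) k => (h (T^[i] a) k : ℝ))
      = R fun (i : Fin q) k => (g (T^[i] c) k : ℝ) := by
    funext i k
    have h1 : h (T^[i] a) = h (T^[i] c) := congrFun heq ⟨i, i.2.trans_le hpN⟩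
    have h2 : T^[i] c = T^[i % q] c := iterate_eq_iterate_mod hc.2 fun h => by omega
    have h3 : h (T^[i % q] c) = g (T^[i % q] c) :=
      hhC _ (mem_iUnion.2 ⟨⟨i % q, Nat.mod_lt _ hq⟩, c, hc, rfl⟩)
    rw [h1, h2, h3]
    rfl
  rw [hac, ← map_sub]
  exact Submodule.mem_map_of_mem hj

/-- The cap is `2 * N` because comparing delay vectors of `z` and `T^[k] z` involves the iterates `i
+ k < 2 * N`. -/
theorem genericallySeparated_same_orbit (hT : Continuous T) (hTi : Function.Injective T)
    {p k r : ℕ} (hk : 0 < k) (hkp : k < p) (hkN : k < N)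
    (hr : HasCoverMultiplicityLE (fixedUpTo T (2 * N) p) r) (hrm : 2 * r ≤ m * min p N + 1) :
    GenericallySeparated T m N {z | z.1 ∈ periodStratum T (2 * N) p ∧ z.2 = T^[k] z.1} := by
  refine .of_locally ?_
  rintro ⟨x, y⟩ ⟨hx, hy⟩
  obtain ⟨U, hUx, hUc, hU⟩ := exists_isClosed_nhds_iterate_injective hT hTi hx.2
  let A := U ∩ fixedUpTo T (2 * N) p
  have hA : IsClosed A := hUc.inter (isClosed_fixedUpTo hT _ p)
  refine ⟨(fun z => (z, T^[k] z)) '' A, ?_, .of_isCompact hT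
    (hA.isCompact.image (continuous_id.prodMk (hT.iterate k))) fun f ε hε => ?_⟩
  · filter_upwards [self_mem_nhdsWithin, nhdsWithin_le_nhds
      (continuous_fst.continuousAt.preimage_mem_nhds hUx)] with z hz hz'
    exact ⟨z.1, ⟨hz', hz.1.1⟩, Prod.ext rfl hz.2.symm⟩
  have hp : 0 < p := hk.trans hkp
  let F : Fin p → Fin p := fun i => ⟨(i + k) % p, Nat.mod_lt _ hp⟩
  have hF : ∀ i, F i < i ∨ i < F i := by
    intro i
    rw [← ne_iff_lt_or_gt]
    intro h
    have h1 : (i + k) % p = i := congrArg Fin.val h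
    have := i.2
    by_cases h2 : i + k < p
    · rw [Nat.mod_eq_of_lt h2] at h1; omega
    · rw [Nat.mod_eq_sub_mod (not_lt.1 h2), Nat.mod_eq_of_lt (by omega)] at h1; omega
  let I₁ : Finset (Fin p) := Finset.univ.filter fun i => i < N ∧ F i < i
  let I₂ : Finset (Fin p) := Finset.univ.filter fun i => i < N ∧ i < F i
  have hI : min p N ≤ I₁.card + I₂.card := by
    rw [← Fin.card_filter_val_lt]
    refine le_trans (Finset.card_le_card ?_) (Finset.card_union_le I₁ I₂)
    intro i hi
    have hi' : (i : ℕ) < N := by simpa using hi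
    rcases hF i with h | h <;> simp [I₁, I₂, hi', h]
  -- The shift `F` has cycles, so not all relations are independent. Those that decrease the index
  -- are, as are those that increase it; keep the larger family.
  obtain ⟨I, lt, hlt, hIlt, hIN, hIcard⟩ : ∃ (I : Finset (Fin p)) (lt : Fin p → Fin p → Prop),
      WellFounded lt ∧ (∀ i ∈ I, lt (F i) i) ∧ (∀ i ∈ I, i < N) ∧ min p N ≤ 2 * I.card := by
    rcases le_total I₁.card I₂.card with h | h
    · exact ⟨I₂, (· > ·), wellFounded_gt, fun i hi => (Finset.mem_filter.1 hi).2.2,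
        fun i hi => (Finset.mem_filter.1 hi).2.1, by omega⟩
    · exact ⟨I₁, (· < ·), wellFounded_lt, fun i hi => (Finset.mem_filter.1 hi).2.2,
        fun i hi => (Finset.mem_filter.1 hi).2.1, by omega⟩
  let L : Submodule ℝ (Fin p → Fin m → ℝ) :=
    { carrier := {w | ∀ i ∈ I, w i = w (F i)}
      add_mem' := fun {v w} hv hw i hi => by
        rw [Pi.add_apply, Pi.add_apply, hv i hi, hw i hi]
      zero_mem' := fun i _ => rfl
      smul_mem' := fun c w hw i hi => by
        rw [Pi.smul_apply, Pi.smul_apply, hw i hi] }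
  have hLr : Module.finrank ℝ L + r ≤ p * m := by
    have h1 := finrank_submodule_le_of_wellFounded hlt F I hIlt L fun w hw => hw
    rw [Module.finrank_fin_fun, Fintype.card_fin] at h1
    have h2 := Nat.mul_le_mul_left m hIcard
    have h3 : m * (2 * I.card) = 2 * (I.card * m) := by ring
    omega
  obtain ⟨h, hhf, -, hh⟩ := exists_approx_notMem_affine (φ := fun i : Fin p => T^[i])
    (fun i => hT.iterate i) hA isClosed_empty (fun i j a ha c hc => hU i j a ha.1 c hc.1)
    (by simp) (hr.of_isClosed_subset hA inter_subset_right) f hε (J := Unit) (fun _ => 0)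
    (fun _ => L) (fun _ => by simpa using hLr)
  refine ⟨h, hhf, ?_⟩
  rintro _ ⟨z, hz, rfl⟩ heq
  refine hh z hz () ?_
  rw [sub_zero]
  intro i hi
  funext a
  have h1 : h (T^[i] z) = h (T^[i] (T^[k] z)) := congrFun heq ⟨i, hIN i hi⟩
  have h2 : T^[i + k] z = T^[(i + k) % p] z :=
    iterate_eq_iterate_mod hz.2 fun h => by have := hIN i hi; omega
  rw [← Function.iterate_add_apply, h2] at h1
  exact congrArg Subtype.val (congrFun h1 a)

theorem genericallySeparated_offDiag (hT : Continuous T) (hTi : Function.Injective T) (hN : 1 ≤ N)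
    (hdim : ∀ M p, N ≤ M → 1 ≤ p →
      ∃ r, HasCoverMultiplicityLE (fixedUpTo T M p) r ∧ 2 * r ≤ m * min p N + 1) :
    GenericallySeparated T m N {z | z.1 ≠ z.2} := by
  -- The index conditions sit inside the sets, which are empty for irrelevant indices.
  let S₁ : ℕ × ℕ → Set (X × X) := fun n => {z | (0 < n.2 ∧ n.2 ≤ n.1 ∧ n.1 ≤ N) ∧
    z.1 ∈ periodStratum T N n.1 ∧ z.2 ∈ periodStratum T N n.2 ∧
      ∀ i < n.1, ∀ j < n.2, T^[i] z.1 ≠ T^[j] z.2}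
  let S₂ : ℕ × ℕ → Set (X × X) := fun n => {z | (0 < n.2 ∧ n.2 < n.1 ∧ n.2 < N) ∧
    z.1 ∈ periodStratum T (2 * N) n.1 ∧ z.2 = T^[n.2] z.1}
  have hS₁ : ∀ n, GenericallySeparated T m N (S₁ n) := by
    intro n
    by_cases hn : 0 < n.2 ∧ n.2 ≤ n.1 ∧ n.1 ≤ N
    · obtain ⟨r, hr, hr2⟩ := hdim N n.1 le_rfl (by omega)
      obtain ⟨s, hs, hs2⟩ := hdim N n.2 le_rfl (by omega)
      rw [min_eq_left (by omega)] at hr2 hs2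
      have := Nat.mul_le_mul_left m hn.2.1
      refine (genericallySeparated_disjoint_orbits hT hTi hn.1 hn.2.2 hr hs
        (by rw [mul_comm]; omega)).mono fun z hz => hz.2
    · exact univ_mem' fun f z hz => absurd hz.1 hn
  have hS₂ : ∀ n, GenericallySeparated T m N (S₂ n) := by
    intro n
    by_cases hn : 0 < n.2 ∧ n.2 < n.1 ∧ n.2 < N
    · obtain ⟨r, hr, hr2⟩ := hdim (2 * N) n.1 (by omega) (by omega)
      exact (genericallySeparated_same_orbit hT hTi hn.1 hn.2.1 hn.2.2 hr hr2).mono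
        fun z hz => hz.2
    · exact univ_mem' fun f z hz => absurd hz.1 hn
  have hcountable : ((range S₁ ∪ (range fun n => Prod.swap ⁻¹' S₁ n)) ∪
      (range S₂ ∪ (range fun n => Prod.swap ⁻¹' S₂ n))).Countable :=
    ((countable_range _).union (countable_range _)).union
      ((countable_range _).union (countable_range _))
  refine (GenericallySeparated.sUnion hcountable ?_).mono ?_
  · rintro _ ((⟨n, rfl⟩ | ⟨n, rfl⟩) | (⟨n, rfl⟩ | ⟨n, rfl⟩))
    exacts [hS₁ n, (hS₁ n).swap, hS₂ n, (hS₂ n).swap]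
  have horbit : ∀ x k, k < N → T^[k] x ≠ x → ∃ n, (x, T^[k] x) ∈ S₂ n := by
    intro x k hkN hne
    obtain ⟨p, hp1, hpN, hp⟩ := exists_mem_periodStratum hTi (M := 2 * N) (by omega) x
    have hmod : T^[k] x = T^[k % p] x := iterate_eq_iterate_mod hp.1 fun h => by omega
    refine ⟨(p, k % p), ⟨Nat.pos_of_ne_zero fun h0 => hne ?_, Nat.mod_lt _ hp1,
      (Nat.mod_le k p).trans_lt hkN⟩, hp, hmod⟩
    have h0 : k % p = 0 := h0
    rw [hmod, h0, Function.iterate_zero, id]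
  rintro ⟨x, y⟩ hxy
  have hxy : x ≠ y := hxy
  obtain ⟨p, hp1, hpN, hp⟩ := exists_mem_periodStratum hTi hN x
  obtain ⟨q, hq1, hqN, hq⟩ := exists_mem_periodStratum hTi hN y
  by_cases hdisj : ∀ i < p, ∀ j < q, T^[i] x ≠ T^[j] y
  · rcases le_total q p with h | h
    · exact ⟨_, .inl (.inl ⟨(p, q), rfl⟩), ⟨hq1, h, hpN⟩, hp, hq, hdisj⟩
    · exact ⟨_, .inl (.inr ⟨(q, p), rfl⟩), ⟨hp1, h, hqN⟩, hq, hp,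
        fun i hi j hj => (hdisj j hj i hi).symm⟩
  -- Cancelling iterates by injectivity shows that one point is an iterate of the other, of exponent
  -- below `N`.
  · push Not at hdisj
    obtain ⟨i, hi, j, hj, hij⟩ := hdisj
    rcases le_total i j with h | h
    · obtain ⟨k, rfl⟩ := Nat.exists_eq_add_of_le h
      rw [Function.iterate_add_apply] at hij
      have hxk : x = T^[k] y := hTi.iterate i hij
      obtain ⟨n, hn⟩ := horbit y k (by omega) (hxk ▸ hxy)
      rw [← hxk] at hn
      exact ⟨_, .inr (.inr ⟨n, rfl⟩), hn⟩
    · obtain ⟨k, rfl⟩ := Nat.exists_eq_add_of_le h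
      rw [Function.iterate_add_apply] at hij
      have hyk : T^[k] x = y := hTi.iterate j hij
      obtain ⟨n, hn⟩ := horbit x k (by omega) (hyk ▸ hxy.symm)
      rw [hyk] at hn
      exact ⟨_, .inr (.inl ⟨n, rfl⟩), hn⟩

end Separation

/-! ### The embedding theorem -/

theorem theorem1 {X : Type*} [MetricSpace X] [CompactSpace X] (T : X ≃ₜ X) (d m : ℕ)
    (hm : 1 ≤ m) (hd : coveringDim X = (d : EReal))
    (hP : ∀ n : ℕ, 1 ≤ n → n ≤ 2 * d →
      coveringDim (periodicUpTo T n) < (((m : ℝ) * (n : ℝ) / 2 : ℝ) : EReal)) :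
    {h : C(X, Fin m → unitInterval) | Topology.IsEmbedding (delayMap T h (2 * d + 1))} ∈
      residual C(X, Fin m → unitInterval) := by
  have hX : HasCoverMultiplicityLE X (d + 1) := by
    refine hasCoverMultiplicityLE_of_coveringDim_lt (c := (d : ℝ) + 1) ?_ fun s hs => ?_
    · rw [hd]
      have : ((d : ℝ) : EReal) < ((d + 1 : ℝ) : EReal) := by
        rw [EReal.coe_lt_coe_iff]; linarith
      exact_mod_cast this
    · have : s < d + 2 := by exact_mod_cast (by linarith : (s : ℝ) < (d : ℝ) + 2)
      omega
  refine mem_of_superset (genericallySeparated_offDiag (N := 2 * d + 1) T.continuous T.injective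
    (by omega) fun M p hM hp => ?_) fun h hh => ?_
  · by_cases hpd : p ≤ 2 * d
    -- The largest integer below `mp/2 + 1`: multiplicity is order plus one.
    · refine ⟨(m * p + 1) / 2, ?_, by rw [min_eq_left (by omega)]; omega⟩
      refine (hasCoverMultiplicityLE_of_coveringDim_lt (hP p hp hpd) fun s hs => ?_).of_isClosed_subset
        (isClosed_fixedUpTo T.continuous M p) fun x hx => ⟨p, hp, le_rfl, hx (by omega)⟩
      have : 2 * s < m * p + 2 := by
        exact_mod_cast (by linarith : 2 * (s : ℝ) < (m : ℝ) * p + 2)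
      omega
    -- For `p ≥ 2d+1` the dimension of `X` suffices: `2(d+1) ≤ m(2d+1) + 1`, which is where the
    -- number of delays enters.
    · refine ⟨d + 1, hX.of_isClosedEmbedding
        (isClosed_fixedUpTo T.continuous M p).isClosedEmbedding_subtypeVal, ?_⟩
      rw [min_eq_right (by omega)]
      have := Nat.mul_le_mul_right (2 * d + 1) hm
      omega
  · have hcont : Continuous (delayMap T h (2 * d + 1)) :=
      continuous_pi fun i => h.continuous.comp (T.continuous.iterate i)
    refine (hcont.isClosedEmbedding fun x y hxy => ?_).isEmbedding
    by_contra hne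
    exact hh (x, y) hne hxy
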